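/- Let $p$ be a prime and let $X$ be a noetherian normal scheme of characteristic $p$ which is $F$-finite, i.e. $F_*\mathcal O_X$ is a finitely generated $\mathcal O_X$-module, where $F$ is the absolute Frobenius morphism ($X$ need not be connected). An $\mathbb R$-divisor is a finite formal sum of prime divisors of $X$ with real coefficients. For an effective $\mathbb R$-divisor $\Delta$ on $X$, the pair $(X,\Delta)$ is called globally $F$-split if for every integer $e>0$ the natural map $$\mathcal O_X \xrightarrow{F^e} F^e_*\mathcal O_X \hookrightarrow F^e_*\mathcal O_X(\lfloor (p^e-1)\Delta\rfloor)$$ splits as a homomorphism of $\mathcal O_X$-modules. Let $(X,\Delta)$ be globally $F$-split, let $D$ be an effective $\mathbb R$-divisor on $X$, and let $$c=\mathrm{fst}(X,\Delta;D):=\sup\{t\in\mathbb R_{\ge 0} \mid (X,\Delta+tD)\text{ is globally }F\text{-split}\}\in[0,\infty]$$ be the $F$-split threshold. Then $c<\infty$ if $D\neq 0$, and $(X,\Delta+cD)$ is globally $F$-split (where $cD:=0$ if $D=0$). -/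

import Mathlib

open AlgebraicGeometry
open scoped ENNReal NNReal

universe u

noncomputable section

namespace FSplit

/-- `X` is of characteristic `p`: the prime `p` vanishes in the global functions, equivalently
the morphism from `X` to `Spec ℤ` factors through `Spec ℤ/pℤ`. -/
def HasChar (X : Scheme.{u}) (p : ℕ) : Prop :=
  (p : Γ(X, ⊤)) = 0

/-- `X` is `F`-finite: `F_* 𝒪_X` is a finitely generated `𝒪_X`-module, i.e. on every affine open
the ring of functions is finitely generated as a module over itself through the `p`-th power
map. -/
def FFinite (X : Scheme.{u}) (p : ℕ) : Prop :=
  ∀ U : X.Opens, IsAffineOpen U →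
    ∃ s : Finset Γ(X, U), ∀ a : Γ(X, U), ∃ c : Γ(X, U) → Γ(X, U), a = ∑ b ∈ s, c b ^ p * b

/-- `X` is normal: all its local rings are integrally closed domains. The scheme is not
assumed to be connected. -/
def IsNormal (X : Scheme.{u}) : Prop :=
  ∀ x : X, IsDomain (X.presheaf.stalk x) ∧ IsIntegrallyClosed (X.presheaf.stalk x)

/-- The prime divisors of `X`, given by their generic points, the points of codimension one
(in the order of Mathlib on `X`, generic points are the maximal points). -/
def PrimeDivisor (X : Scheme.{u}) : Type u :=
  {x : X // Order.coheight x = 1}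

/-- Weil divisors with coefficients in `R` (`R = ℤ` or `R = ℝ` below) on a noetherian scheme:
finite formal sums of prime divisors. The divisor is effective when it is `≥ 0`. -/
abbrev Divisor (X : Scheme.{u}) (R : Type) [Zero R] : Type u :=
  PrimeDivisor X →₀ R

/-- The round-down of the `ℝ`-divisor `r Δ`. -/
def floorMul {X : Scheme.{u}} (r : ℝ) (Δ : Divisor X ℝ) : Divisor X ℤ :=
  Δ.mapRange (fun a : ℝ => ⌊r * a⌋) (by simp)

/-- The generic points of the irreducible components of `X` that meet `U`. -/
def GenericPt {X : Scheme.{u}} (U : X.Opens) : Type u :=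
  {η : X // η ∈ U ∧ Order.coheight η = 0}

/-- Rational functions on `U`: families of elements of the local rings of `X` at the generic
points of the irreducible components that meet `U`. If `X` is integral and `U` is not empty, this
is the function field. -/
def RatFun {X : Scheme.{u}} (U : X.Opens) : Type u :=
  ∀ η : GenericPt U, X.presheaf.stalk η.1

instance {X : Scheme.{u}} (U : X.Opens) : CommRing (RatFun U) :=
  inferInstanceAs (CommRing (∀ η : GenericPt U, X.presheaf.stalk η.1))

/-- A regular function on `U`, seen as a rational function. -/
def toRatFun {X : Scheme.{u}} (U : X.Opens) : Γ(X, U) →+* RatFun U :=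
  RingHom.pi fun η : GenericPt U => (X.presheaf.germ U η.1 η.2.1).hom

instance {X : Scheme.{u}} (U : X.Opens) : Algebra Γ(X, U) (RatFun U) :=
  (toRatFun U).toAlgebra

/-- Restriction of rational functions. -/
def RatFun.res {X : Scheme.{u}} {U V : X.Opens} (h : U ≤ V) (f : RatFun V) : RatFun U :=
  fun η => f ⟨η.1, h η.2.1, η.2.2⟩

/-- For a point `x` of codimension one, a generization `η` of `x`, an element `f` of the local
ring at `η`, and an integer `n`: the order of `f` along `x` is at least `-n`. On a normal
noetherian scheme the local ring at `x` is a discrete valuation ring with maximal ideal `𝔪`, whose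
fraction field is the local ring at the generic point `η`, and the condition says that `f` lies in
the fractional ideal `𝔪⁻ⁿ`: it reads `𝔪ⁿ f ⊆ 𝒪_{X,x}` if `n ≥ 0`, and `f ∈ 𝔪⁻ⁿ` if `n < 0`. -/
def OrdGENeg {X : Scheme.{u}} {x η : X} (h : η ⤳ x) (n : ℤ) (f : X.presheaf.stalk η) : Prop :=
  ∀ a ∈ IsLocalRing.maximalIdeal (X.presheaf.stalk x) ^ n.toNat,
    ∃ b ∈ IsLocalRing.maximalIdeal (X.presheaf.stalk x) ^ (-n).toNat,
      (X.presheaf.stalkSpecializes h).hom b = (X.presheaf.stalkSpecializes h).hom a * f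

/-- The sections over `U` of the sheaf `𝒪_X(E)`: the rational functions `f` on `U` whose order
along every prime divisor meeting `U` is at least minus the coefficient of `E`
(for `f` not zero near that prime divisor). -/
def sections {X : Scheme.{u}} (E : Divisor X ℤ) (U : X.Opens) :
    Submodule Γ(X, U) (RatFun U) where
  carrier := {f | ∀ (x : PrimeDivisor X) (_ : x.1 ∈ U) (η : GenericPt U) (h : η.1 ⤳ x.1),
    OrdGENeg h (E x) (f η)}
  zero_mem' := fun x _ η h a _ => ⟨0, Submodule.zero_mem _, by
    rw [map_zero]; exact (mul_zero _).symm⟩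
  add_mem' := by
    intro f g hf hg x hx η h a ha
    obtain ⟨b, hb, hb'⟩ := hf x hx η h a ha
    obtain ⟨c, hc, hc'⟩ := hg x hx η h a ha
    refine ⟨b + c, Submodule.add_mem _ hb hc, ?_⟩
    rw [map_add, hb', hc']
    exact (mul_add _ _ _).symm
  smul_mem' := by
    intro r f hf x hx η h a ha
    obtain ⟨b, hb, hb'⟩ := hf x hx η h a ha
    refine ⟨X.presheaf.germ U x.1 hx r * b, Ideal.mul_mem_left _ _ hb, ?_⟩
    have h1 : (X.presheaf.stalkSpecializes h).hom (X.presheaf.germ U x.1 hx r)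
        = X.presheaf.germ U η.1 η.2.1 r :=
      TopCat.Presheaf.germ_stalkSpecializes_apply X.presheaf hx h r
    have h2 : (r • f) η = X.presheaf.germ U η.1 η.2.1 r * f η := rfl
    rw [map_mul, hb', h1, h2]
    ring

/-- Restriction maps of the sheaf `𝒪_X(E)`. -/
def sections.res {X : Scheme.{u}} {E : Divisor X ℤ} {U V : X.Opens} (h : U ≤ V)
    (f : sections E V) : sections E U :=
  ⟨RatFun.res h f.1, fun x hx η hη => f.2 x (h hx) ⟨η.1, h η.2.1, η.2.2⟩ hη⟩

/-- The inclusion `𝒪_X ↪ 𝒪_X(E)` for an effective divisor `E`. -/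
def incl {X : Scheme.{u}} {E : Divisor X ℤ} (hE : 0 ≤ E) (U : X.Opens) (a : Γ(X, U)) :
    sections E U :=
  ⟨toRatFun U a, by
    intro x hx η h c _
    refine ⟨c * X.presheaf.germ U x.1 hx a, ?_, ?_⟩
    · have h0 : (-(E x)).toNat = 0 := Int.toNat_of_nonpos (neg_nonpos.mpr (hE x))
      rw [h0, pow_zero, Ideal.one_eq_top]
      exact Submodule.mem_top
    · rw [map_mul]
      exact congrArg _ (TopCat.Presheaf.germ_stalkSpecializes_apply X.presheaf hx h a)⟩

/-- A splitting of the natural map `𝒪_X → F^e_* 𝒪_X ↪ F^e_* 𝒪_X(E)` as a map of sheaves of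
`𝒪_X`-modules, for an effective divisor `E` on a scheme of characteristic `p`.

The sections of `F^e_* 𝒪_X(E)` over `U` are those of `𝒪_X(E)`, where a function `a` acts as
multiplication by `a ^ (p ^ e)`; so an `𝒪_X`-linear map `F^e_* 𝒪_X(E) → 𝒪_X` is a family of
additive maps that is compatible with restrictions and satisfies `map_smul`. The natural map sends
`a` to `a ^ (p ^ e)`, and `retraction` says that the composition with it is the identity. -/
structure Splitting {X : Scheme.{u}} (p e : ℕ) {E : Divisor X ℤ} (hE : 0 ≤ E) where
  /-- the map on sections over an open set -/
  app : ∀ U : X.Opens, sections E U →+ Γ(X, U)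
  map_res : ∀ {U V : X.Opens} (h : U ≤ V) (f : sections E V),
    app U (sections.res h f) = X.presheaf.map (CategoryTheory.homOfLE h).op (app V f)
  map_smul : ∀ (U : X.Opens) (a : Γ(X, U)) (f : sections E U),
    app U (a ^ (p ^ e) • f) = a * app U f
  retraction : ∀ (U : X.Opens) (a : Γ(X, U)), app U (incl hE U (a ^ (p ^ e))) = a

theorem floorMul_nonneg {X : Scheme.{u}} {r : ℝ} (hr : 0 ≤ r) {Δ : Divisor X ℝ} (hΔ : 0 ≤ Δ) :
    0 ≤ floorMul r Δ := by
  intro x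
  exact Int.floor_nonneg.mpr (mul_nonneg hr (hΔ x))

theorem pow_sub_one_nonneg (p e : ℕ) [Fact p.Prime] : (0 : ℝ) ≤ (p : ℝ) ^ e - 1 :=
  sub_nonneg.mpr (one_le_pow₀ (by exact_mod_cast (Fact.out : p.Prime).one_le))

/-- The pair `(X, Δ)` is globally `F`-split: `Δ` is effective and, for every `e > 0`, the natural
map `𝒪_X → F^e_* 𝒪_X(⌊(p^e - 1) Δ⌋)` splits as a homomorphism of `𝒪_X`-modules. -/
def GloballyFSplit {X : Scheme.{u}} (p : ℕ) [Fact p.Prime] (Δ : Divisor X ℝ) : Prop :=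
  ∃ hΔ : 0 ≤ Δ, ∀ e : ℕ, 0 < e →
    Nonempty (Splitting p e (floorMul_nonneg (pow_sub_one_nonneg p e) hΔ))

/-- The `F`-split threshold `fst(X, Δ; D)`: the supremum, in `[0, ∞]`, of the real numbers `t ≥ 0`
such that `(X, Δ + t D)` is globally `F`-split. -/
def fst {X : Scheme.{u}} (p : ℕ) [Fact p.Prime] (Δ D : Divisor X ℝ) : ℝ≥0∞ :=
  sSup {c : ℝ≥0∞ | ∃ t : ℝ≥0, c = t ∧ GloballyFSplit p (Δ + (t : ℝ) • D)}

end FSplit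

end

/-!
Splittings are compared across consecutive levels `e`, and obstructed along single prime divisors.

*The pair at the threshold is split.* If `φ` splits `𝒪_X → F^{e+1}_* 𝒪_X(E')` and `p E ≤ E'`, then
`s ↦ φ (s ^ p)` splits `𝒪_X → F^e_* 𝒪_X(E)`, because the `p`-th power is additive in
characteristic `p` and maps `𝒪_X(E)` to `𝒪_X(p E)` (`FSplit.Splitting.compPow`). Let `c > 0` be the
finite threshold. The round-down `⌊(p^e - 1)(Δ + c D)⌋` may jump at `c`, so that it is not reached
from below at level `e`. It is reached one level higher: since `p (p^e - 1) < p^{e+1} - 1`,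
the divisor `⌊(p^{e+1} - 1)(Δ + t D)⌋` already dominates `p ⌊(p^e - 1)(Δ + c D)⌋` for some `t < c`
(`FSplit.mul_floor_le_floor`), hence for some `t` at which the pair is split.

*The threshold is finite.* At a prime divisor `x` on which `D` is positive, a large `t` makes the
coefficient of `⌊(p - 1)(Δ + t D)⌋` at least `p`. The local ring at `x` is a discrete valuation
ring, and a uniformizer extends to a function `a` on a neighbourhood of `x` that vanishes along no
other prime divisor (`FSplit.exists_local_equation`). Then `a⁻ᵖ` is a section of the divisor, and
a splitting `φ` would give `1 = φ (aᵖ · a⁻ᵖ) = a φ (a⁻ᵖ)` although `a` vanishes at `x`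
(`FSplit.Splitting.coeff_lt`).
-/

namespace FSplit

open IsLocalRing

variable {X : Scheme.{u}} {p : ℕ}

/-! ### Powers of sections -/

@[ext]
theorem RatFun.ext {U : X.Opens} {f g : RatFun U} (h : ∀ η, f η = g η) : f = g :=
  funext h

theorem HasChar.cast_stalk (hchar : HasChar X p) (x : X) : (p : X.presheaf.stalk x) = 0 := by
  have h := congrArg (X.presheaf.germ ⊤ x trivial).hom hchar
  rwa [map_natCast, map_zero] at h

theorem HasChar.add_pow [hp : Fact p.Prime] (hchar : HasChar X p) {x : X}
    (f g : X.presheaf.stalk x) : (f + g) ^ p = f ^ p + g ^ p := by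
  obtain ⟨r, hr⟩ := exists_add_pow_prime_eq hp.out f g
  rw [hr, hchar.cast_stalk]
  ring

/-- For `n ≥ 0`, `𝔪ⁿ f ⊆ 𝒪_{X,x}` implies `𝔪ᵏ f^p ⊆ 𝒪_{X,x}` as soon as `k ≥ p n`. -/
theorem OrdGENeg.pow {x η : X} {h : η ⤳ x} {n k : ℤ} (hn : 0 ≤ n) (hk : p * n ≤ k)
    {f : X.presheaf.stalk η} (hf : OrdGENeg h n f) : OrdGENeg h k (f ^ p) := by
  obtain ⟨n, rfl⟩ := Int.eq_ofNat_of_zero_le hn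
  obtain ⟨k, rfl⟩ := Int.eq_ofNat_of_zero_le ((by positivity : (0 : ℤ) ≤ p * n).trans hk)
  have hk' : n * p ≤ k := by rw [mul_comm]; exact_mod_cast hk
  have hpow : ∀ m : ℕ, ∀ a ∈ (maximalIdeal (X.presheaf.stalk x) ^ n) ^ m,
      ∃ b, (X.presheaf.stalkSpecializes h).hom b =
        (X.presheaf.stalkSpecializes h).hom a * f ^ m := by
    intro m
    induction m with
    | zero => exact fun a _ => ⟨a, by simp⟩
    | succ m ih =>
      intro a ha
      rw [pow_succ] at ha
      refine Submodule.mul_induction_on ha (fun y hy z hz => ?_) fun y z hy hz => ?_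
      · obtain ⟨b, hb⟩ := ih y hy
        obtain ⟨c, -, hc⟩ := hf z (by simpa using hz)
        refine ⟨b * c, ?_⟩
        rw [map_mul, map_mul, hb, hc]
        ring
      · obtain ⟨b, hb⟩ := hy
        obtain ⟨c, hc⟩ := hz
        refine ⟨b + c, ?_⟩
        rw [map_add, map_add, hb, hc]
        ring
  intro a ha
  obtain ⟨b, hb⟩ := hpow p a (by
    rw [← pow_mul]
    exact Ideal.pow_le_pow_right hk' (by simpa using ha))
  exact ⟨b, by simp, hb⟩

/-- The `p`-th power map `𝒪_X(E) → 𝒪_X(E')`, for an effective divisor `E` with `p E ≤ E'`. -/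
noncomputable def sections.pow [Fact p.Prime] (hchar : HasChar X p) {E E' : Divisor X ℤ} (hE : 0 ≤ E)
    (hEE' : ∀ x, p * E x ≤ E' x) (U : X.Opens) : sections E U →+ sections E' U where
  toFun f := ⟨f.1 ^ p, fun x hx η h => (f.2 x hx η h).pow (hE x) (hEE' x)⟩
  map_zero' := Subtype.ext (zero_pow (Fact.out : p.Prime).ne_zero)
  map_add' f g := Subtype.ext (RatFun.ext fun η => hchar.add_pow (f.1 η) (g.1 η))

/-- If `φ` is a splitting at level `e + 1` for `E' ≥ p E`, then `s ↦ φ (s ^ p)` is a splitting at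
level `e` for `E`. -/
noncomputable def Splitting.compPow [Fact p.Prime] (hchar : HasChar X p) {e : ℕ} {E E' : Divisor X ℤ}
    {hE : 0 ≤ E} {hE' : 0 ≤ E'} (hEE' : ∀ x, p * E x ≤ E' x) (φ : Splitting p (e + 1) hE') :
    Splitting p e hE where
  app U := (φ.app U).comp (sections.pow hchar hE hEE' U)
  map_res h f := φ.map_res h (sections.pow hchar hE hEE' _ f)
  map_smul U a f := by
    have h : sections.pow hchar hE hEE' U (a ^ p ^ e • f) =
        a ^ p ^ (e + 1) • sections.pow hchar hE hEE' U f :=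
      Subtype.ext (by
        change (a ^ p ^ e • f.1) ^ p = a ^ p ^ (e + 1) • f.1 ^ p
        rw [smul_pow, ← pow_mul, ← pow_succ])
    rw [AddMonoidHom.comp_apply, h, φ.map_smul]
    rfl
  retraction U a := by
    have h : sections.pow hchar hE hEE' U (incl hE U (a ^ p ^ e)) =
        incl hE' U (a ^ p ^ (e + 1)) :=
      Subtype.ext (by
        change toRatFun U (a ^ p ^ e) ^ p = toRatFun U (a ^ p ^ (e + 1))
        rw [← map_pow, ← pow_mul, ← pow_succ])
    rw [AddMonoidHom.comp_apply, h, φ.retraction]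

/-! ### Local equations of prime divisors -/

theorem eq_of_specializes_of_coheight_le {x y : X} (h : x ⤳ y) {n : ℕ}
    (hx : Order.coheight x = n) (hy : Order.coheight y ≤ n) : y = x := by
  have hyx : y ≤ x := h
  by_contra hne
  have hlt : y < x := lt_of_le_not_ge hyx fun hxy => hne (Specializes.antisymm hxy h).eq
  have := Order.coheight_strictAnti hlt (by rw [hx]; exact ENat.natCast_lt_top n)
  exact absurd (hx ▸ this) (not_lt.mpr hy)

/-- If a generator of the maximal ideal of the local ring at `x` is not invertible at a
generization `z` of `x`, then `z = x`. -/
theorem eq_of_germ_generates {x z : X} (h : z ⤳ x) {t : X.presheaf.stalk x}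
    (ht : maximalIdeal (X.presheaf.stalk x) = Ideal.span {t})
    (hz : ¬ IsUnit ((X.presheaf.stalkSpecializes h).hom t)) : z = x := by
  have hc : (maximalIdeal (X.presheaf.stalk z)).comap (X.presheaf.stalkSpecializes h).hom =
      maximalIdeal (X.presheaf.stalk x) := by
    refine ((maximalIdeal.isMaximal _).eq_of_le (Ideal.IsPrime.ne_top inferInstance) ?_).symm
    rw [ht, Ideal.span_singleton_le_iff_mem]
    exact hz
  have h1 : (Spec.map (X.presheaf.stalkSpecializes h)) (closedPoint _) = closedPoint _ :=
    PrimeSpectrum.ext hc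
  calc z = X.fromSpecStalk z (closedPoint (X.presheaf.stalk z)) :=
        X.fromSpecStalk_closedPoint.symm
    _ = X.fromSpecStalk x (Spec.map (X.presheaf.stalkSpecializes h)
          (closedPoint (X.presheaf.stalk z))) := by
        rw [← X.SpecMap_stalkSpecializes_fromSpecStalk h]
        rfl
    _ = x := by
        rw [h1]
        exact X.fromSpecStalk_closedPoint

theorem maximalIdeal_isPrincipal [IsLocallyNoetherian X] (hnormal : IsNormal X) {x : X}
    (hx : Order.coheight x = 1) : (maximalIdeal (X.presheaf.stalk x)).IsPrincipal := by
  have := (hnormal x).1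
  have := (hnormal x).2
  have : Ring.KrullDimLE 1 (X.presheaf.stalk x) := krullDimLE_of_coheight_le hx.le
  have h : IsIntegrallyClosed (X.presheaf.stalk x) ∧
      ∀ P : Ideal (X.presheaf.stalk x), P ≠ ⊥ → P.IsPrime → P = maximalIdeal _ :=
    ⟨inferInstance, fun P hP hP' =>
      eq_maximalIdeal (Ring.krullDimLE_one_iff_of_noZeroDivisors.mp inferInstance P hP hP')⟩
  exact ((tfae_of_isNoetherianRing_of_isLocalRing_of_isDomain (X.presheaf.stalk x)).out 3 4).mp h

/-- A prime divisor on a noetherian normal scheme has a local equation: a function `a` near its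
generic point `x` which is a uniformizer at `x` and is invertible at all other points of
codimension at most one of its domain. -/
theorem exists_local_equation [AlgebraicGeometry.IsNoetherian X] (hnormal : IsNormal X) {x : X}
    (hx : Order.coheight x = 1) :
    ∃ (U : X.Opens) (hxU : x ∈ U) (a : Γ(X, U)),
      maximalIdeal (X.presheaf.stalk x) = Ideal.span {X.presheaf.germ U x hxU a} ∧
      ∀ (y : X) (hy : y ∈ U), Order.coheight y ≤ 1 → y ≠ x →
        IsUnit (X.presheaf.germ U y hy a) := by
  obtain ⟨t, ht⟩ := maximalIdeal_isPrincipal hnormal hx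
  obtain ⟨V, hxV, a, rfl⟩ := X.presheaf.exists_germ_eq t
  obtain ⟨S, hSfin, hScl, hSirr, hS⟩ :=
    TopologicalSpace.NoetherianSpace.exists_finite_set_isClosed_irreducible
      (X.basicOpen a).isOpen.isClosed_compl
  -- The components of the zero locus of `a` that avoid `x` are removed.
  let W : X.Opens := ⟨⋂ T ∈ {T ∈ S | x ∉ T}, Tᶜ,
    (hSfin.subset (Set.sep_subset _ _)).isOpen_biInter fun T hT => (hScl T hT.1).isOpen_compl⟩
  have hxW : x ∈ W := Set.mem_iInter₂.mpr fun T hT => hT.2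
  let i : V ⊓ W ⟶ V := CategoryTheory.homOfLE inf_le_left
  have hgerm : ∀ y (hy : y ∈ V ⊓ W), X.presheaf.germ (V ⊓ W) y hy (X.presheaf.map i.op a) =
      X.presheaf.germ V y hy.1 a :=
    fun y hy => TopCat.Presheaf.germ_res_apply X.presheaf i y hy a
  refine ⟨V ⊓ W, ⟨hxV, hxW⟩, X.presheaf.map i.op a, ht.trans (by rw [← hgerm x ⟨hxV, hxW⟩]), fun y hy hy1 hne => ?_⟩
  rw [hgerm]
  by_contra hunit
  have hyZ : y ∈ (X.basicOpen a : Set X)ᶜ := fun h =>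
    hunit ((X.mem_basicOpen a y hy.1).mp h)
  rw [hS] at hyZ
  obtain ⟨T, hTS, hyT⟩ := hyZ
  have hxT : x ∈ T := by
    by_contra hxT
    exact Set.mem_iInter₂.mp hy.2 T ⟨hTS, hxT⟩ hyT
  -- The remaining components contain `x`, so their generic point is `x` itself.
  obtain ⟨z, hz⟩ := QuasiSober.sober (hSirr T hTS) (hScl T hTS)
  have hzx : z ⤳ x := hz.specializes hxT
  have hzV : z ∈ V := hzx.mem_open V.isOpen hxV
  have hz_unit : ¬ IsUnit (X.presheaf.germ V z hzV a) := by
    rw [← X.mem_basicOpen a z hzV]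
    have hzZ : z ∈ (X.basicOpen a : Set X)ᶜ := by
      rw [hS]
      exact ⟨T, hTS, hz.mem⟩
    exact hzZ
  have hzeq : z = x := eq_of_germ_generates hzx ht (by
    rwa [TopCat.Presheaf.germ_stalkSpecializes_apply X.presheaf hxV hzx a])
  subst hzeq
  exact hne (eq_of_specializes_of_coheight_le (hz.specializes hyT) (n := 1) hx hy1)

/-! ### Bounds on the coefficients -/

/-- If `𝒪_X → F_* 𝒪_X(E)` splits, then all coefficients of `E` are smaller than `p`. -/
theorem Splitting.coeff_lt [AlgebraicGeometry.IsNoetherian X] (hnormal : IsNormal X)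
    {E : Divisor X ℤ} {hE : 0 ≤ E} (φ : Splitting p 1 hE) (x : PrimeDivisor X) : E x < p := by
  by_contra! hx
  obtain ⟨U, hxU, a, ha, hunit⟩ := exists_local_equation hnormal x.2
  have hη : ∀ η : GenericPt U, IsUnit (X.presheaf.germ U η.1 η.2.1 a) := fun η =>
    hunit η.1 η.2.1 (by simp [η.2.2]) fun h => by
      have h1 := x.2
      rw [← h, η.2.2] at h1
      exact zero_ne_one h1
  let g : sections E U := ⟨fun η => (((hη η).unit⁻¹ : (X.presheaf.stalk η.1)ˣ) : _) ^ p, by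
    intro y hy η h c hc
    have h0 : (-(E y)).toNat = 0 := Int.toNat_of_nonpos (neg_nonpos.mpr (hE y))
    -- It is enough to write `c` as a multiple of `aᵖ` in the local ring at `y`.
    suffices h : ∃ b, c = X.presheaf.germ U y.1 hy a ^ p * b by
      obtain ⟨b, rfl⟩ := h
      refine ⟨b, by rw [h0, pow_zero, Ideal.one_eq_top]; exact Submodule.mem_top, ?_⟩
      rw [map_mul, map_pow,
        show (X.presheaf.stalkSpecializes h).hom (X.presheaf.germ U y.1 hy a) = _ from
          TopCat.Presheaf.germ_stalkSpecializes_apply X.presheaf hy h a,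
        mul_right_comm, ← mul_pow, (hη η).mul_val_inv, one_pow, one_mul]
    by_cases hyx : y = x
    · subst hyx
      refine (Ideal.mem_span_singleton.mp ?_ : _ ∣ c)
      rw [← Ideal.span_singleton_pow, ← ha]
      exact Ideal.pow_le_pow_right (by omega) hc
    · have hu := (hunit y.1 hy y.2.le fun h => hyx (Subtype.ext h)).pow p
      exact hu.dvd⟩
  have hg : a ^ p ^ 1 • g = incl hE U (1 ^ p ^ 1) := Subtype.ext (RatFun.ext fun η => by
    change X.presheaf.germ U η.1 η.2.1 (a ^ p ^ 1) *
      (((hη η).unit⁻¹ : (X.presheaf.stalk η.1)ˣ) : X.presheaf.stalk η.1) ^ p =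
      X.presheaf.germ U η.1 η.2.1 (1 ^ p ^ 1)
    rw [pow_one, one_pow, map_one, map_pow, ← mul_pow, (hη η).mul_val_inv, one_pow])
  have h1 : a * φ.app U g = 1 := by rw [← φ.map_smul, hg, φ.retraction]
  have h2 : X.presheaf.germ U x.1 hxU a ∈ maximalIdeal (X.presheaf.stalk x.1) := by
    rw [ha]
    exact Ideal.mem_span_singleton_self _
  exact (mem_maximalIdeal _).mp h2 ((IsUnit.of_mul_eq_one _ h1).map (X.presheaf.germ U x.1 hxU).hom)

/-- The round-down at `c` is controlled by the round-down one level higher at all `t` which are at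
least `c (p^{e+1} - p) / (p^{e+1} - 1)`, a number smaller than `c` if `c > 0`. -/
theorem mul_floor_le_floor {q δ d c t : ℝ} {p : ℕ} (hp : 1 ≤ p) (hδ : 0 ≤ δ) (hd : 0 ≤ d)
    (ht : c * (p * q - p) ≤ t * (p * q - 1)) :
    p * ⌊(q - 1) * (δ + c * d)⌋ ≤ ⌊(p * q - 1) * (δ + t * d)⌋ := by
  rw [Int.le_floor]
  push_cast
  have hp' : (1 : ℝ) ≤ p := by exact_mod_cast hp
  have h1 := mul_le_mul_of_nonneg_left (Int.floor_le ((q - 1) * (δ + c * d)))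
    (zero_le_one.trans hp')
  have h2 := mul_le_mul_of_nonneg_right ht hd
  have h3 := mul_le_mul_of_nonneg_right hp' hδ
  linarith

theorem GloballyFSplit.mul_coeff_lt [Fact p.Prime] [AlgebraicGeometry.IsNoetherian X]
    (hnormal : IsNormal X) {Δ D : Divisor X ℝ} (hΔ : 0 ≤ Δ) {t : ℝ≥0}
    (h : GloballyFSplit p (Δ + (t : ℝ) • D)) (x : PrimeDivisor X) : t * D x < p := by
  obtain ⟨hpos, h⟩ := h
  obtain ⟨φ⟩ := h 1 one_pos
  have hlt := φ.coeff_lt hnormal x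
  have hlt' : ((p : ℝ) ^ 1 - 1) * (Δ x + t * D x) < p := by
    change ⌊((p : ℝ) ^ 1 - 1) * (Δ x + t * D x)⌋ < (p : ℤ) at hlt
    exact_mod_cast Int.floor_lt.mp hlt
  have hp2 : (2 : ℝ) ≤ p := by exact_mod_cast (Fact.out : p.Prime).two_le
  have h1 : 0 ≤ Δ x + t * D x := hpos x
  have h2 : 0 ≤ Δ x := hΔ x
  nlinarith

theorem fst_ne_top [Fact p.Prime] [AlgebraicGeometry.IsNoetherian X]
    (hnormal : IsNormal X) {Δ D : Divisor X ℝ} (hΔ : 0 ≤ Δ) (hD : 0 ≤ D) (hD0 : D ≠ 0) :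
    fst p Δ D ≠ ∞ := by
  obtain ⟨x, hx⟩ := Finsupp.ne_iff.mp hD0
  have hx : 0 < D x := lt_of_le_of_ne (hD x) (Ne.symm hx)
  refine ne_top_of_le_ne_top (ENNReal.ofReal_ne_top (r := p / D x)) (sSup_le ?_)
  rintro _ ⟨t, rfl, ht⟩
  rw [← ENNReal.ofReal_coe_nnreal]
  refine ENNReal.ofReal_le_ofReal ?_
  rw [le_div_iff₀ hx]
  exact (ht.mul_coeff_lt hnormal hΔ x).le

theorem GloballyFSplit.add_fst_smul [Fact p.Prime] (hchar : HasChar X p) {Δ D : Divisor X ℝ}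
    (hΔ : GloballyFSplit p Δ) (hD : 0 ≤ D) : GloballyFSplit p (Δ + (fst p Δ D).toReal • D) := by
  set c := (fst p Δ D).toReal with hc
  -- The case `c = 0` also covers an infinite threshold, as `toReal ∞ = 0`.
  rcases eq_or_ne c 0 with h0 | h0
  · rwa [h0, zero_smul, add_zero]
  have hc0 : 0 < c := lt_of_le_of_ne ENNReal.toReal_nonneg (Ne.symm h0)
  have hΔ0 := hΔ.1
  have hp : 1 < (p : ℝ) := by exact_mod_cast (Fact.out : p.Prime).one_lt
  refine ⟨fun x => add_nonneg (hΔ0 x) (mul_nonneg hc0.le (hD x)), fun e he => ?_⟩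
  have hq : 1 < (p : ℝ) ^ e := one_lt_pow₀ hp he.ne'
  have hpq : 0 < (p : ℝ) * p ^ e - 1 := by nlinarith
  -- Here `c (p^{e+1} - p) / (p^{e+1} - 1) < c`, so the pair is split for some `t` in between.
  obtain ⟨_, ⟨t, rfl, hpos, ht⟩, hlt⟩ : ∃ s ∈ {s : ℝ≥0∞ | ∃ t : ℝ≥0, s = t ∧
      GloballyFSplit p (Δ + (t : ℝ) • D)},
      ENNReal.ofReal (c * (p * p ^ e - p) / (p * p ^ e - 1)) < s := by
    refine lt_sSup_iff.mp ?_
    rw [ENNReal.ofReal_lt_iff_lt_toReal]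
    · change _ < c
      rw [div_lt_iff₀ hpq]
      nlinarith
    · exact div_nonneg (mul_nonneg hc0.le (by nlinarith)) hpq.le
    · exact fun h => h0 (by rw [hc, fst, h, ENNReal.toReal_top])
  rw [← ENNReal.ofReal_coe_nnreal] at hlt
  have hlt := (ENNReal.ofReal_lt_ofReal_iff_of_nonneg
    (div_nonneg (mul_nonneg hc0.le (by nlinarith)) hpq.le)).mp hlt
  rw [div_lt_iff₀ hpq] at hlt
  obtain ⟨φ⟩ := ht (e + 1) e.succ_pos
  refine ⟨φ.compPow hchar fun x => ?_⟩
  change (p : ℤ) * ⌊((p : ℝ) ^ e - 1) * (Δ x + c * D x)⌋ ≤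
    ⌊((p : ℝ) ^ (e + 1) - 1) * (Δ x + t * D x)⌋
  rw [pow_succ' (p : ℝ) e]
  exact mul_floor_le_floor (Fact.out : p.Prime).one_le (hΔ0 x) (hD x) hlt.le

end FSplit

theorem theorem3p2 (p : ℕ) [Fact p.Prime] (X : Scheme.{u}) [AlgebraicGeometry.IsNoetherian X]
    (hnormal : FSplit.IsNormal X) (hchar : FSplit.HasChar X p) (hfin : FSplit.FFinite X p)
    (Δ D : FSplit.Divisor X ℝ) (hΔ : FSplit.GloballyFSplit p Δ) (hD : 0 ≤ D) :
    (D ≠ 0 → FSplit.fst p Δ D ≠ ∞) ∧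
      FSplit.GloballyFSplit p (Δ + (FSplit.fst p Δ D).toReal • D) :=
  ⟨FSplit.fst_ne_top hnormal hΔ.1 hD, hΔ.add_fst_smul hchar hD⟩
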